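/- **Theorem 1.** Let $(\boldsymbol X_i,Y_i)_{i\ge 1}$ be i.i.d. copies of $(\boldsymbol X,Y)$, where $\boldsymbol X$ is $\mathbb R^q$-valued and $Y\in\{0,1\}$. Assume the logistic regression model and the null hypothesis $H_0:\boldsymbol\beta=\boldsymbol\beta_0$, that is, $\Pr(Y=1\mid \boldsymbol X)=\pi(\boldsymbol X^T\boldsymbol\beta_0)$ a.s., where $\pi(s)=1/(1+e^{-s})$. Put $\boldsymbol g(\boldsymbol x,y,\boldsymbol\beta)=\boldsymbol x\,(y-\pi(\boldsymbol x^T\boldsymbol\beta))$. Assume: * **C1.** $\boldsymbol\beta_0$ is the only $\boldsymbol\beta\in\mathbb R^q$ for which $E[\boldsymbol g(\boldsymbol X,Y,\boldsymbol\beta)]$ exists and equals $\boldsymbol 0$. * **C2.** With probability tending to $1$ as $n\to\infty$, $\boldsymbol 0$ lies in the convex hull of the points $\boldsymbol g(\boldsymbol X_i,Y_i,\boldsymbol\beta_0)$, $i=1,\dots,n$. * **C3.** With probability tending to $1$ as $n\to\infty$, the matrix $\sum_{i=1}^n \boldsymbol g(\boldsymbol X_i,Y_i,\boldsymbol\beta_0)\,\boldsymbol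 g(\boldsymbol X_i,Y_i,\boldsymbol\beta_0)^T$ is positive definite. * **C4.** $E[\boldsymbol g(\boldsymbol X,Y,\boldsymbol\beta_0)\,\boldsymbol g(\boldsymbol X,Y,\boldsymbol\beta_0)^T]$ exists and is positive definite. * **C5.** $\partial \boldsymbol g(\boldsymbol X,Y,\boldsymbol\beta)/\partial\boldsymbol\beta$ is continuous in $\boldsymbol\beta$ in a neighbourhood of $\boldsymbol\beta_0$. * **C6.** $\|\partial \boldsymbol g(\boldsymbol X,Y,\boldsymbol\beta)/\partial\boldsymbol\beta\|$ and $\|\boldsymbol g(\boldsymbol X,Y,\boldsymbol\beta)\|^3$ are bounded by an integrable function $G_1(\boldsymbol X,Y)$ for all $\boldsymbol\beta$ in a neighbourhood of $\boldsymbol\beta_0$. * **C7.** $E[\partial \boldsymbol g(\boldsymbol X,Y,\boldsymbol\beta)/\partial\boldsymbol\beta]$ at $\boldsymbol\beta=\boldsymbol\beta_0$ exists and has rank $q$. * **C8.** $\partial^2 \boldsymbol g(\boldsymbol X,Y,\boldsymbol\beta)/\partial\boldsymbol\beta\,\partial\boldsymbol\beta^T$ is continuous in $\boldsymbol\beta$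 in a neighbourhood of $\boldsymbol\beta_0$. * **C9.** $\|\partial^2 \boldsymbol g(\boldsymbol X,Y,\boldsymbol\beta)/\partial\boldsymbol\beta\,\partial\boldsymbol\beta^T\|$ is bounded by an integrable function $G_2(\boldsymbol X,Y)$ for all $\boldsymbol\beta$ in a neighbourhood of $\boldsymbol\beta_0$. Let $\boldsymbol t=\boldsymbol t_n(\boldsymbol\beta_0)\in\mathbb R^q$ be a solution of $$\frac1n\sum_{i=1}^n\frac{\boldsymbol g(\boldsymbol X_i,Y_i,\boldsymbol\beta_0)}{1+\boldsymbol t^T\boldsymbol g(\boldsymbol X_i,Y_i,\boldsymbol\beta_0)}=\boldsymbol 0,\qquad 1+\boldsymbol t^T\boldsymbol g(\boldsymbol X_i,Y_i,\boldsymbol\beta_0)\ge \tfrac1n\quad(i=1,\dots,n),$$ with $\boldsymbol t=\boldsymbol 0$ on samples for which there is none, and let $$p_i(\boldsymbol\beta_0)=\frac1n\cdot\frac1{1+\boldsymbol t^T\boldsymbol g(\boldsymbol X_i,Y_i,\boldsymbol\beta_0)},\quad i=1,\dots,n,$$ be the empirical-likelihood weights. Let $\boldsymbol u=(1/n,\dots,1/n)$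 and $d_\phi(\boldsymbol p,\boldsymbol r)=\sum_{i=1}^n r_i\,\phi(p_i/r_i)$. Let $\Phi$ be the class of twice differentiable convex functions $\phi:(0,\infty)\to\mathbb R$ with $\phi(1)=\phi'(1)=0$ and $\phi''(1)>0$. Then for every $\phi\in\Phi$, $$T_n^\phi(\boldsymbol\beta_0)=\frac{2n}{\phi''(1)}\,d_\phi(\boldsymbol u,\boldsymbol p(\boldsymbol\beta_0))\ \xrightarrow{\ \mathcal L\ }\ \chi^2_q\qquad(n\to\infty).$$ This is also the limit law of the empirical likelihood ratio statistic $2\sum_{i=1}^n\log\bigl(1+\boldsymbol t^T\boldsymbol g(\boldsymbol X_i,Y_i,\boldsymbol\beta_0)\bigr)$. -/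

import Mathlib

open MeasureTheory ProbabilityTheory Filter Topology

namespace LogisticEL

/-- The score function `g(x, y, β) = (y - π(xᵀβ)) x` of the logistic regression model, where
`π(s) = 1 / (1 + exp (-s))` is the inverse of the logit function. -/
noncomputable def score {q : ℕ} (x : EuclideanSpace ℝ (Fin q)) (y : ℝ)
    (β : EuclideanSpace ℝ (Fin q)) : EuclideanSpace ℝ (Fin q) :=
  (y - Real.sigmoid (inner ℝ x β)) • x

/-- The logistic regression model with true parameter `β` holds for the joint law `ν` of `(X, Y)`:
`Y` is `{0, 1}`-valued and the conditional probability of `Y = 1` given `X` is `π(Xᵀβ)`. -/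
def IsLogisticModel {q : ℕ} (ν : Measure (EuclideanSpace ℝ (Fin q) × ℝ))
    (β : EuclideanSpace ℝ (Fin q)) : Prop :=
  (∀ᵐ z ∂ν, z.2 = 0 ∨ z.2 = 1) ∧
    ν[Set.indicator {z : EuclideanSpace ℝ (Fin q) × ℝ | z.2 = 1} (fun _ => (1 : ℝ)) |
        MeasurableSpace.comap Prod.fst inferInstance]
      =ᵐ[ν] fun z => Real.sigmoid (inner ℝ z.1 β)

/-! ### Empirical likelihood for a fixed sample `(x i, y i)`, `i : Fin n` -/

/-- `t` is an empirical-likelihood multiplier at `β`: it solves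
`(1/n) ∑ i, g(x i, y i, β) / (1 + tᵀ g(x i, y i, β)) = 0`, and `1 + tᵀ g(x i, y i, β) ≥ 1/n` for
every `i`, that is, the weights `(1/n) / (1 + tᵀ g(x i, y i, β))` lie in `(0, 1]`. -/
def IsMultiplier {q n : ℕ} (x : Fin n → EuclideanSpace ℝ (Fin q)) (y : Fin n → ℝ)
    (β t : EuclideanSpace ℝ (Fin q)) : Prop :=
  (∀ i, 1 / (n : ℝ) ≤ 1 + inner ℝ t (score (x i) (y i) β)) ∧
    (1 / (n : ℝ)) • ∑ i, (1 / (1 + inner ℝ t (score (x i) (y i) β))) • score (x i) (y i) β = 0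

open Classical in
/-- The multiplier `t(β)` of the sample. On the samples for which no multiplier exists (the
statistics below are then undefined) the conventional value is `0`. -/
noncomputable def multiplier {q n : ℕ} (x : Fin n → EuclideanSpace ℝ (Fin q)) (y : Fin n → ℝ)
    (β : EuclideanSpace ℝ (Fin q)) : EuclideanSpace ℝ (Fin q) :=
  if h : ∃ t, IsMultiplier x y β t then h.choose else 0

/-- The empirical-likelihood weights `p_i(β) = (1/n) * 1 / (1 + t(β)ᵀ g(x i, y i, β))`. -/
noncomputable def weights {q n : ℕ} (x : Fin n → EuclideanSpace ℝ (Fin q)) (y : Fin n → ℝ)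
    (β : EuclideanSpace ℝ (Fin q)) (i : Fin n) : ℝ :=
  (1 / (n : ℝ)) * (1 / (1 + inner ℝ (multiplier x y β) (score (x i) (y i) β)))

/-- The uniform probability vector `u = (1/n, …, 1/n)`. -/
noncomputable def uniformWeights (n : ℕ) (_ : Fin n) : ℝ := 1 / (n : ℝ)

/-- The empirical-likelihood weights are strictly positive. -/
theorem weights_pos {q n : ℕ} (x : Fin n → EuclideanSpace ℝ (Fin q)) (y : Fin n → ℝ)
    (β : EuclideanSpace ℝ (Fin q)) (i : Fin n) : 0 < weights x y β i := by
  have hn : (0 : ℝ) < n := by exact_mod_cast i.pos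
  have h1 : (0 : ℝ) < 1 / (n : ℝ) := by positivity
  have h2 : 0 < 1 + inner ℝ (multiplier x y β) (score (x i) (y i) β) := by
    unfold multiplier
    split_ifs with h
    · exact lt_of_lt_of_le h1 (h.choose_spec.1 i)
    · simp
  unfold weights
  positivity

/-- The class `Φ` of divergence functions on `(0, ∞)`: twice differentiable and convex, with
`φ(1) = 0`, `φ'(1) = 0` and `φ''(1) > 0`. Values of `φ` outside `(0, ∞)` are irrelevant. -/
structure IsDivergenceFunction (φ : ℝ → ℝ) : Prop where
  differentiableOn : DifferentiableOn ℝ φ (Set.Ioi 0)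
  differentiableOn_deriv : DifferentiableOn ℝ (deriv φ) (Set.Ioi 0)
  convexOn : ConvexOn ℝ (Set.Ioi 0) φ
  map_one : φ 1 = 0
  deriv_one : deriv φ 1 = 0
  deriv_deriv_one : 0 < deriv (deriv φ) 1

/-- The `φ`-divergence `d_φ(p, r) = ∑ i, r i * φ (p i / r i)` between two strictly positive
probability vectors; the conventions for zero entries play no role, see `weights_pos`. -/
noncomputable def phiDivergence {n : ℕ} (φ : ℝ → ℝ) (p r : Fin n → ℝ) : ℝ :=
  ∑ i, r i * φ (p i / r i)

/-- The empirical `φ`-divergence statistic `T_n^φ(β) = (2n / φ''(1)) d_φ(u, p(β))`. -/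
noncomputable def phiStatistic {q n : ℕ} (φ : ℝ → ℝ) (x : Fin n → EuclideanSpace ℝ (Fin q))
    (y : Fin n → ℝ) (β : EuclideanSpace ℝ (Fin q)) : ℝ :=
  2 * (n : ℝ) / deriv (deriv φ) 1 * phiDivergence φ (uniformWeights n) (weights x y β)

/-- The kernel of the empirical log-likelihood, `ℓ(β) = - ∑ i, log (1 + t(β)ᵀ g(x i, y i, β))`. -/
noncomputable def logLikelihood {q n : ℕ} (x : Fin n → EuclideanSpace ℝ (Fin q)) (y : Fin n → ℝ)
    (β : EuclideanSpace ℝ (Fin q)) : ℝ :=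
  -∑ i, Real.log (1 + inner ℝ (multiplier x y β) (score (x i) (y i) β))

/-- The empirical likelihood ratio statistic `-2 ℓ(β)`. -/
noncomputable def likelihoodRatioStatistic {q n : ℕ} (x : Fin n → EuclideanSpace ℝ (Fin q))
    (y : Fin n → ℝ) (β : EuclideanSpace ℝ (Fin q)) : ℝ :=
  -2 * logLikelihood x y β

/-! ### Regularity conditions; `ν` is the joint law of `(X, Y)` -/

/-- `β₀` is the only solution of `E[g(X, Y, β)] = 0`; being a solution includes that the
expectation exists. -/
def CondC1 {q : ℕ} (ν : Measure (EuclideanSpace ℝ (Fin q) × ℝ))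
    (β₀ : EuclideanSpace ℝ (Fin q)) : Prop :=
  ∀ β, (Integrable (fun z => score z.1 z.2 β) ν ∧ ∫ z, score z.1 z.2 β ∂ν = 0) ↔ β = β₀

/-- The null vector is in the convex hull of the `g(x i, y i, β)`. -/
def CondC2 {q n : ℕ} (x : Fin n → EuclideanSpace ℝ (Fin q)) (y : Fin n → ℝ)
    (β : EuclideanSpace ℝ (Fin q)) : Prop :=
  0 ∈ convexHull ℝ (Set.range fun i => score (x i) (y i) β)

/-- The matrix `∑ i, g(x i, y i, β) g(x i, y i, β)ᵀ` is positive definite. -/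
def CondC3 {q n : ℕ} (x : Fin n → EuclideanSpace ℝ (Fin q)) (y : Fin n → ℝ)
    (β : EuclideanSpace ℝ (Fin q)) : Prop :=
  (Matrix.of fun j k : Fin q => ∑ i, score (x i) (y i) β j * score (x i) (y i) β k).PosDef

/-- The matrix `E[g(X, Y, β) g(X, Y, β)ᵀ]` exists and is positive definite. -/
def CondC4 {q : ℕ} (ν : Measure (EuclideanSpace ℝ (Fin q) × ℝ))
    (β : EuclideanSpace ℝ (Fin q)) : Prop :=
  (∀ j k : Fin q, Integrable (fun z => score z.1 z.2 β j * score z.1 z.2 β k) ν) ∧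
    (Matrix.of fun j k : Fin q => ∫ z, score z.1 z.2 β j * score z.1 z.2 β k ∂ν).PosDef

/-- `∂g(X, Y, β)/∂β` is continuous in a neighbourhood of `β₀`. -/
def CondC5 {q : ℕ} (ν : Measure (EuclideanSpace ℝ (Fin q) × ℝ))
    (β₀ : EuclideanSpace ℝ (Fin q)) : Prop :=
  ∃ U ∈ 𝓝 β₀, ∀ᵐ z ∂ν, ContinuousOn (fun β => fderiv ℝ (score z.1 z.2) β) U

/-- `‖∂g(X, Y, β)/∂β‖` and `‖g(X, Y, β)‖³` are bounded by an integrable function of `(X, Y)` in a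
neighbourhood of `β₀`. -/
def CondC6 {q : ℕ} (ν : Measure (EuclideanSpace ℝ (Fin q) × ℝ))
    (β₀ : EuclideanSpace ℝ (Fin q)) : Prop :=
  ∃ G : EuclideanSpace ℝ (Fin q) × ℝ → ℝ, Integrable G ν ∧ ∃ U ∈ 𝓝 β₀, ∀ᵐ z ∂ν, ∀ β ∈ U,
    ‖fderiv ℝ (score z.1 z.2) β‖ ≤ G z ∧ ‖score z.1 z.2 β‖ ^ 3 ≤ G z

/-- `E[∂g(X, Y, β)/∂β]` exists and has rank `q`. -/
def CondC7 {q : ℕ} (ν : Measure (EuclideanSpace ℝ (Fin q) × ℝ))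
    (β : EuclideanSpace ℝ (Fin q)) : Prop :=
  Integrable (fun z => fderiv ℝ (score z.1 z.2) β) ν ∧
    Module.finrank ℝ (LinearMap.range (∫ z, fderiv ℝ (score z.1 z.2) β ∂ν).toLinearMap) = q

/-- `∂²g(X, Y, β)/∂β∂βᵀ` is continuous in a neighbourhood of `β₀`. -/
def CondC8 {q : ℕ} (ν : Measure (EuclideanSpace ℝ (Fin q) × ℝ))
    (β₀ : EuclideanSpace ℝ (Fin q)) : Prop :=
  ∃ U ∈ 𝓝 β₀, ∀ᵐ z ∂ν, ContinuousOn (fun β => fderiv ℝ (fderiv ℝ (score z.1 z.2)) β) U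

/-- `‖∂²g(X, Y, β)/∂β∂βᵀ‖` is bounded by an integrable function of `(X, Y)` in a neighbourhood of
`β₀`. -/
def CondC9 {q : ℕ} (ν : Measure (EuclideanSpace ℝ (Fin q) × ℝ))
    (β₀ : EuclideanSpace ℝ (Fin q)) : Prop :=
  ∃ G : EuclideanSpace ℝ (Fin q) × ℝ → ℝ, Integrable G ν ∧ ∃ U ∈ 𝓝 β₀, ∀ᵐ z ∂ν, ∀ β ∈ U,
    ‖fderiv ℝ (fderiv ℝ (score z.1 z.2)) β‖ ≤ G z

/-! ### The limit law -/

/-- The `χ²` law with `q` degrees of freedom: the law of `Z₁² + ⋯ + Z_q²` for independent standard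
normal variables `Z₁, …, Z_q`. -/
noncomputable def chiSquared (q : ℕ) : Measure ℝ :=
  (Measure.pi fun _ : Fin q => gaussianReal 0 1).map fun z => ∑ j, z j ^ 2

instance (q : ℕ) : IsProbabilityMeasure (chiSquared q) :=
  Measure.isProbabilityMeasure_map
    (Finset.measurable_fun_sum _ fun j _ => (measurable_pi_apply j).pow_const 2).aemeasurable

end LogisticEL

open LogisticEL

namespace LogisticEL

/-! Every statistic here is a sum `∑ f(tᵀgᵢ)` with `f(a) = a² + o(a²)`, and such a sum is
asymptotically a squared norm to which the central limit theorem applies. Standardize the scores by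
an injective `A` and put `vᵢ = n^(-1/2) A gᵢ`. Outside an event of small probability, the `vᵢ` are
uniformly small (third moments), `∑ vᵢvᵢᵀ` is close to the identity (law of large numbers), and `z =
∑ vᵢ` is bounded (tightness). The rest is deterministic. The concave function `s ↦ ∑ log(1 + sᵀvᵢ)`
has an interior maximum in a fixed ball, whose critical equation is the multiplier equation
(`exists_sum_smul_eq_zero`). Expanding that equation gives `s ≈ z`, hence `∑ f(sᵀvᵢ) ≈ ∑ (sᵀvᵢ)² ≈
‖s‖² ≈ ‖z‖²` (`exists_abs_sum_sub_norm_sq_le`). Multipliers need not be unique, but their inner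
products with the scores are (`IsVectorMultiplier.inner_eq`), so the solution found this way
computes the statistic; the same fact makes the statistic measurable. The likelihood ratio is the
case `φ(x) = x log x - x + 1`. -/

/-! ### Deterministic expansion of the multiplier equation -/

theorem log_one_add_le_sub_sq {a : ℝ} (ha : |a| ≤ 1 / 4) :
    Real.log (1 + a) ≤ a - a ^ 2 / 6 := by
  have h := Real.abs_log_sub_add_sum_range_le (x := -a) (by rw [abs_neg]; linarith) 2
  -- For `|a| ≤ 1/4` the Taylor remainder is at most `a²/3`, and `1/2 - 1/3 = 1/6`.
  have h1 : |(-a)| ^ (2 + 1) / (1 - |(-a)|) ≤ a ^ 2 / 3 := by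
    rw [abs_neg, div_le_iff₀ (by linarith)]
    have h2 : |a| ^ (2 + 1) = a ^ 2 * |a| := by rw [pow_succ, sq_abs]
    rw [h2]
    nlinarith [sq_nonneg a, abs_nonneg a]
  have h3 := (abs_le.mp (h.trans h1)).2
  simp only [Finset.sum_range_succ, Finset.sum_range_zero, sub_neg_eq_add] at h3
  norm_num at h3
  linarith

variable {E : Type*} [NormedAddCommGroup E] [InnerProductSpace ℝ E]

theorem inner_self_sum_rankOne {n : ℕ} (v : Fin n → E) (s : E) :
    inner ℝ s ((∑ i, InnerProductSpace.rankOne ℝ (v i) (v i)) s) = ∑ i, (inner ℝ s (v i)) ^ 2 := by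
  simp only [_root_.sum_apply, inner_sum, InnerProductSpace.rankOne_apply,
    real_inner_smul_right]
  refine Finset.sum_congr rfl fun i _ => ?_
  rw [real_inner_comm s (v i)]; ring

/-- If the second moment operator of the points is close to the identity, so is the quadratic form
it defines. -/
theorem abs_sum_sq_inner_sub_le {n : ℕ} {v : Fin n → E} {δ : ℝ}
    (h : ‖(∑ i, InnerProductSpace.rankOne ℝ (v i) (v i)) - ContinuousLinearMap.id ℝ E‖ ≤ δ)
    (s : E) : |∑ i, (inner ℝ s (v i)) ^ 2 - ‖s‖ ^ 2| ≤ δ * ‖s‖ ^ 2 := by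
  have h1 : ∑ i, (inner ℝ s (v i)) ^ 2 - ‖s‖ ^ 2 = inner ℝ s
      (((∑ i, InnerProductSpace.rankOne ℝ (v i) (v i)) - ContinuousLinearMap.id ℝ E) s) := by
    rw [← inner_self_sum_rankOne, _root_.sub_apply, inner_sub_right,
      ContinuousLinearMap.id_apply, real_inner_self_eq_norm_sq]
  rw [h1]
  calc _ ≤ ‖s‖ * ‖((∑ i, InnerProductSpace.rankOne ℝ (v i) (v i)) -
        ContinuousLinearMap.id ℝ E) s‖ := abs_real_inner_le_norm _ _
    _ ≤ ‖s‖ * (δ * ‖s‖) := by gcongr; exact ContinuousLinearMap.le_of_opNorm_le _ h s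
    _ = _ := by ring

/-- The concave dual of the empirical likelihood problem attains its maximum near the origin. -/
theorem exists_sum_smul_eq_zero [FiniteDimensional ℝ E] {n : ℕ} {v : Fin n → E} {M δ : ℝ}
    (hM : 0 < M) (hδ : δ ≤ 1 / 2) (hMδ : 13 * M * δ ≤ 1 / 4) (hv : ∀ i, ‖v i‖ ≤ δ)
    (hS : ‖(∑ i, InnerProductSpace.rankOne ℝ (v i) (v i)) - ContinuousLinearMap.id ℝ E‖ ≤ δ)
    (hz : ‖∑ i, v i‖ ≤ M) :
    ∃ s : E, ‖s‖ ≤ 13 * M ∧ ∑ i, (1 / (1 + inner ℝ s (v i))) • v i = 0 := by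
  have hsmall : ∀ s : E, ‖s‖ ≤ 13 * M → ∀ i, |inner ℝ s (v i)| ≤ 1 / 4 := fun s hs i =>
    calc |inner ℝ s (v i)| ≤ ‖s‖ * ‖v i‖ := abs_real_inner_le_norm _ _
      _ ≤ 13 * M * δ := mul_le_mul hs (hv i) (norm_nonneg _) (by positivity)
      _ ≤ 1 / 4 := hMδ
  have hpos : ∀ s : E, ‖s‖ ≤ 13 * M → ∀ i, 1 + inner ℝ s (v i) ≠ 0 := fun s hs i => by
    have := (abs_le.mp (hsmall s hs i)).1
    intro h0; linarith
  set F : E → ℝ := fun s => ∑ i, Real.log (1 + inner ℝ s (v i)) with hF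
  have hcont : ContinuousOn F (Metric.closedBall 0 (13 * M)) := by
    refine continuousOn_finsetSum _ fun i _ => ContinuousOn.log (by fun_prop) fun s hs => ?_
    exact hpos s (by simpa using hs) i
  obtain ⟨s, hs, hmax⟩ := (isCompact_closedBall (0 : E) (13 * M)).exists_isMaxOn
    ⟨0, by simp; positivity⟩ hcont
  have hs' : ‖s‖ ≤ 13 * M := by simpa using hs
  have hF0 : 0 ≤ F s := by
    have := hmax (show (0 : E) ∈ Metric.closedBall 0 (13 * M) by simp; positivity)
    simpa [hF] using this
  -- The quadratic form is at least `(1 - δ)‖s‖² ≥ ‖s‖²/2`, which turns the coefficient `1/6` into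
  -- `1/12`.
  have hFs : F s ≤ ‖s‖ * M - ‖s‖ ^ 2 / 12 := by
    have h1 : F s ≤ ∑ i, (inner ℝ s (v i) - (inner ℝ s (v i)) ^ 2 / 6) :=
      Finset.sum_le_sum fun i _ => log_one_add_le_sub_sq (hsmall s hs' i)
    rw [Finset.sum_sub_distrib, ← inner_sum, ← Finset.sum_div] at h1
    have h2 := (abs_le.mp (abs_sum_sq_inner_sub_le hS s)).1
    have h3 : inner ℝ s (∑ i, v i) ≤ ‖s‖ * M :=
      (real_inner_le_norm _ _).trans (by gcongr)
    nlinarith [sq_nonneg ‖s‖]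
  -- On the sphere of radius `13M` the bound equals `(13 - 169/12)M² < 0`, whereas `F s ≥ F 0 = 0`.
  -- Any radius above `12M` would do.
  have hlt : ‖s‖ < 13 * M := by
    refine lt_of_le_of_ne hs' fun h => ?_
    rw [h] at hFs
    nlinarith
  refine ⟨s, hs', ?_⟩
  have hloc : IsLocalMax F s := hmax.isLocalMax
    (Filter.mem_of_superset (Metric.isOpen_ball.mem_nhds (by simpa using hlt))
      Metric.ball_subset_closedBall)
  have hder : HasFDerivAt F (∑ i, (1 + inner ℝ s (v i))⁻¹ • innerSL ℝ (v i)) s := by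
    refine HasFDerivAt.fun_sum fun i _ => HasFDerivAt.log ?_ (hpos s hs' i)
    refine HasFDerivAt.const_add _ ?_
    have : (fun t : E => inner ℝ t (v i)) = fun t => innerSL ℝ (v i) t := by
      ext t; simp [real_inner_comm]
    rw [this]
    exact (innerSL ℝ (v i)).hasFDerivAt
  have hzero := hloc.hasFDerivAt_eq_zero hder
  refine ext_inner_right ℝ fun u => ?_
  have := congrArg (fun L => L u) hzero
  simpa [sum_inner, real_inner_smul_left] using this

/-- Quadratic expansion: near the origin the statistic `∑ f(sᵀvᵢ)` built from a solution `s` of the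
multiplier equation is close to the squared norm of the sum of the points. -/
theorem exists_abs_sum_sub_norm_sq_le [FiniteDimensional ℝ E] {f : ℝ → ℝ}
    (hf : ∀ κ > 0, ∃ η > 0, ∀ a, |a| ≤ η → |f a - a ^ 2| ≤ κ * a ^ 2) {M ε : ℝ} (hM : 0 < M)
    (hε : 0 < ε) :
    ∃ δ > 0, ∀ (n : ℕ) (v : Fin n → E), (∀ i, ‖v i‖ ≤ δ) →
      ‖(∑ i, InnerProductSpace.rankOne ℝ (v i) (v i)) - ContinuousLinearMap.id ℝ E‖ ≤ δ →
      ‖∑ i, v i‖ ≤ M →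
      ∃ s : E, (∀ i, |inner ℝ s (v i)| ≤ 1 / 4) ∧ ∑ i, (1 / (1 + inner ℝ s (v i))) • v i = 0 ∧
        |∑ i, f (inner ℝ s (v i)) - ‖∑ i, v i‖ ^ 2| ≤ ε := by
  set R := 13 * M with hR
  have hRpos : 0 < R := by positivity
  obtain ⟨η, hη, hfη⟩ := hf (ε / (6 * R ^ 2)) (by positivity)
  -- `Kδ` collects the errors of `Q ≈ ‖s‖²` (term `R²`) and of `‖s‖² ≈ ‖z‖²` (the product);
  -- replacing `f` by the square costs at most `ε/2` separately, since `Q ≤ 2R²`.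
  set K := R ^ 2 + (R + 3 * R ^ 2) * (R + M) with hK
  have hKpos : 0 < K := by positivity
  refine ⟨min (min (1 / 2) (1 / (4 * R))) (min (η / R) (ε / (2 * K))), by positivity, ?_⟩
  set δ := min (min (1 / 2) (1 / (4 * R))) (min (η / R) (ε / (2 * K))) with hδ
  have hδpos : 0 < δ := by positivity
  have hδ1 : δ ≤ 1 / 2 := (min_le_left _ _).trans (min_le_left _ _)
  have hδ2 : R * δ ≤ 1 / 4 := by
    have : δ ≤ 1 / (4 * R) := (min_le_left _ _).trans (min_le_right _ _)
    rw [le_div_iff₀ (by positivity)] at this; linarith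
  have hδ3 : R * δ ≤ η := by
    have : δ ≤ η / R := (min_le_right _ _).trans (min_le_left _ _)
    rw [le_div_iff₀ (by positivity)] at this; linarith
  have hδ4 : K * δ ≤ ε / 2 := by
    have : δ ≤ ε / (2 * K) := (min_le_right _ _).trans (min_le_right _ _)
    rw [le_div_iff₀ (by positivity)] at this; linarith
  intro n v hv hS hz
  obtain ⟨s, hsR, hs0⟩ := exists_sum_smul_eq_zero hM hδ1 hδ2 hv hS hz
  have hsmall : ∀ i, |inner ℝ s (v i)| ≤ R * δ := fun i =>
    calc |inner ℝ s (v i)| ≤ ‖s‖ * ‖v i‖ := abs_real_inner_le_norm _ _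
      _ ≤ R * δ := mul_le_mul hsR (hv i) (norm_nonneg _) (by positivity)
  refine ⟨s, fun i => (hsmall i).trans hδ2, hs0, ?_⟩
  set Q := ∑ i, (inner ℝ s (v i)) ^ 2 with hQ
  have hQs := abs_sum_sq_inner_sub_le hS s
  have hQnn : 0 ≤ Q := Finset.sum_nonneg fun i _ => sq_nonneg _
  have hsR2 : ‖s‖ ^ 2 ≤ R ^ 2 := by gcongr
  have hQ1 : |Q - ‖s‖ ^ 2| ≤ δ * R ^ 2 := hQs.trans (by gcongr)
  have hQ2 : Q ≤ 2 * R ^ 2 := by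
    have := (abs_le.mp hQ1).2
    nlinarith [sq_nonneg R]
  have hfQ : |∑ i, f (inner ℝ s (v i)) - Q| ≤ ε / 2 := by
    rw [hQ, ← Finset.sum_sub_distrib]
    calc _ ≤ ∑ i, |f (inner ℝ s (v i)) - (inner ℝ s (v i)) ^ 2| := Finset.abs_sum_le_sum_abs _ _
      _ ≤ ∑ i, ε / (6 * R ^ 2) * (inner ℝ s (v i)) ^ 2 :=
          Finset.sum_le_sum fun i _ => hfη _ ((hsmall i).trans hδ3)
      _ = ε / (6 * R ^ 2) * Q := by rw [hQ, Finset.mul_sum]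
      _ ≤ ε / (6 * R ^ 2) * (2 * R ^ 2) := by gcongr
      _ ≤ ε / 2 := by
          rw [div_mul_eq_mul_div, div_le_div_iff₀ (by positivity) (by positivity)]
          nlinarith [mul_pos hε (pow_pos hRpos 2)]
  set z := ∑ i, v i with hzdef
  have hzs : ‖s - z‖ ≤ (R + 3 * R ^ 2) * δ := by
    -- From `a²/(1 + a) = a - 1 + 1/(1 + a)`: summed against `vᵢ`, the last term vanishes by the
    -- multiplier equation and the first is the second moment operator applied to `s`.
    have hid : s - z = -(((∑ i, InnerProductSpace.rankOne ℝ (v i) (v i)) -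
        ContinuousLinearMap.id ℝ E) s) +
        ∑ i, ((inner ℝ s (v i)) ^ 2 / (1 + inner ℝ s (v i))) • v i := by
      have h1 : ∑ i, ((inner ℝ s (v i)) ^ 2 / (1 + inner ℝ s (v i))) • v i =
          ∑ i, (inner ℝ s (v i) • v i - v i + (1 / (1 + inner ℝ s (v i))) • v i) := by
        refine Finset.sum_congr rfl fun i _ => ?_
        have hne : 1 + inner ℝ s (v i) ≠ 0 := by
          have := (abs_le.mp ((hsmall i).trans hδ2)).1
          intro h0; linarith
        have hcomb : inner ℝ s (v i) • v i - v i + (1 / (1 + inner ℝ s (v i))) • v i =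
            (inner ℝ s (v i) - 1 + 1 / (1 + inner ℝ s (v i))) • v i := by
          rw [add_smul, sub_smul, one_smul]
        rw [hcomb]
        congr 1
        field_simp
        ring
      rw [h1, Finset.sum_add_distrib, hs0, Finset.sum_sub_distrib]
      simp only [_root_.sub_apply, _root_.sum_apply,
        InnerProductSpace.rankOne_apply, ContinuousLinearMap.id_apply, real_inner_comm s]
      rw [← hzdef]
      abel
    rw [hid]
    have h2 : ‖∑ i, ((inner ℝ s (v i)) ^ 2 / (1 + inner ℝ s (v i))) • v i‖ ≤ 3 * R ^ 2 * δ := by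
      calc _ ≤ ∑ i, ‖((inner ℝ s (v i)) ^ 2 / (1 + inner ℝ s (v i))) • v i‖ := norm_sum_le _ _
        _ ≤ ∑ i, ((inner ℝ s (v i)) ^ 2 * (3 / 2 * δ)) := by
            refine Finset.sum_le_sum fun i _ => ?_
            have h3 := (abs_le.mp ((hsmall i).trans hδ2)).1
            have h4 : (0 : ℝ) < 1 + inner ℝ s (v i) := by linarith
            rw [norm_smul, Real.norm_eq_abs, abs_of_nonneg (by positivity), ← mul_assoc]
            gcongr
            · rw [div_le_iff₀ h4]
              nlinarith [sq_nonneg (inner ℝ s (v i))]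
            · exact hv i
        _ = Q * (3 / 2 * δ) := by rw [hQ, Finset.sum_mul]
        _ ≤ 2 * R ^ 2 * (3 / 2 * δ) := by gcongr
        _ = _ := by ring
    calc _ ≤ _ := norm_add_le _ _
      _ ≤ δ * R + 3 * R ^ 2 * δ := by
          rw [norm_neg]
          refine add_le_add ((ContinuousLinearMap.le_of_opNorm_le _ hS s).trans ?_) h2
          gcongr
      _ = _ := by ring
  have hsz : |‖s‖ ^ 2 - ‖z‖ ^ 2| ≤ (R + 3 * R ^ 2) * δ * (R + M) := by
    have h1 : ‖s‖ ^ 2 - ‖z‖ ^ 2 = (‖s‖ - ‖z‖) * (‖s‖ + ‖z‖) := by ring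
    rw [h1, abs_mul, abs_of_nonneg (by positivity : 0 ≤ ‖s‖ + ‖z‖)]
    gcongr
    exact (abs_norm_sub_norm_le s z).trans hzs
  have htri : ∑ i, f (inner ℝ s (v i)) - ‖z‖ ^ 2 =
      (∑ i, f (inner ℝ s (v i)) - Q) + (Q - ‖s‖ ^ 2) + (‖s‖ ^ 2 - ‖z‖ ^ 2) := by ring
  rw [htri]
  calc _ ≤ _ := abs_add_three _ _ _
    _ ≤ ε / 2 + δ * R ^ 2 + (R + 3 * R ^ 2) * δ * (R + M) := by gcongr
    _ = ε / 2 + K * δ := by rw [hK]; ring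
    _ ≤ ε := by linarith

/-! ### Uniqueness of the inner products and measurability of the statistics -/

section Multiplier

variable {E : Type*} [NormedAddCommGroup E] [InnerProductSpace ℝ E]

/-- `t` is an empirical-likelihood multiplier of the vectors `w i`. -/
def IsVectorMultiplier {n : ℕ} (w : Fin n → E) (t : E) : Prop :=
  (∀ i, 1 / (n : ℝ) ≤ 1 + inner ℝ t (w i)) ∧
    (1 / (n : ℝ)) • ∑ i, (1 / (1 + inner ℝ t (w i))) • w i = 0

open Classical in
/-- An empirical-likelihood multiplier of the vectors `w i`, or `0` if there is none. -/
noncomputable def vectorMultiplier {n : ℕ} (w : Fin n → E) : E :=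
  if h : ∃ t, IsVectorMultiplier w t then h.choose else 0

/-- Both sides choose from definitionally equal existence statements, so even the chosen witnesses
coincide. -/
theorem multiplier_eq_vectorMultiplier {q n : ℕ} (x : Fin n → EuclideanSpace ℝ (Fin q))
    (y : Fin n → ℝ) (β : EuclideanSpace ℝ (Fin q)) :
    multiplier x y β = vectorMultiplier fun i => score (x i) (y i) β := rfl

theorem isVectorMultiplier_vectorMultiplier {n : ℕ} {w : Fin n → E}
    (h : ∃ t, IsVectorMultiplier w t) : IsVectorMultiplier w (vectorMultiplier w) := by
  rw [vectorMultiplier, dif_pos h]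
  exact h.choose_spec

theorem vectorMultiplier_eq_zero {n : ℕ} {w : Fin n → E}
    (h : ¬ ∃ t, IsVectorMultiplier w t) : vectorMultiplier w = 0 := by
  rw [vectorMultiplier, dif_neg h]

theorem IsVectorMultiplier.pos {n : ℕ} {w : Fin n → E} {t : E} (h : IsVectorMultiplier w t)
    (i : Fin n) : 0 < 1 + inner ℝ t (w i) := by
  have hn : (0 : ℝ) < n := by exact_mod_cast i.pos
  exact lt_of_lt_of_le (by positivity) (h.1 i)

theorem IsVectorMultiplier.sum_eq_zero {n : ℕ} {w : Fin n → E} {t : E}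
    (h : IsVectorMultiplier w t) : ∑ i, (1 / (1 + inner ℝ t (w i))) • w i = 0 := by
  rcases Nat.eq_zero_or_pos n with rfl | hn
  · simp
  · have hn' : (1 / (n : ℝ)) ≠ 0 := by positivity
    exact (smul_eq_zero.mp h.2).resolve_left hn'

/-- The inner products `tᵀwᵢ` do not depend on the choice of the multiplier `t`. -/
theorem IsVectorMultiplier.inner_eq {n : ℕ} {w : Fin n → E} {s t : E}
    (hs : IsVectorMultiplier w s) (ht : IsVectorMultiplier w t) (i : Fin n) :
    inner ℝ s (w i) = inner ℝ t (w i) := by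
  -- Strict monotonicity of `a ↦ 1/(1 + a)`: the difference of the two multiplier equations, paired
  -- with `t - s`, is a sum of nonnegative terms equal to zero.
  have key : ∀ j, (1 / (1 + inner ℝ s (w j)) - 1 / (1 + inner ℝ t (w j))) *
      (inner ℝ t (w j) - inner ℝ s (w j)) =
      (inner ℝ t (w j) - inner ℝ s (w j)) ^ 2 /
        ((1 + inner ℝ s (w j)) * (1 + inner ℝ t (w j))) := fun j => by
    have h1 := (hs.pos j).ne'
    have h2 := (ht.pos j).ne'
    field_simp
    ring
  have hsum : ∑ j, (inner ℝ t (w j) - inner ℝ s (w j)) ^ 2 /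
        ((1 + inner ℝ s (w j)) * (1 + inner ℝ t (w j))) = 0 := by
    have h1 : inner ℝ (t - s) (∑ j, (1 / (1 + inner ℝ s (w j))) • w j -
        ∑ j, (1 / (1 + inner ℝ t (w j))) • w j) = (0 : ℝ) := by
      rw [hs.sum_eq_zero, ht.sum_eq_zero]; simp
    rw [← Finset.sum_sub_distrib, inner_sum] at h1
    rw [← h1]
    refine Finset.sum_congr rfl fun j _ => ?_
    rw [← key j, ← sub_smul, real_inner_smul_right, inner_sub_left]
  have h0 := (Finset.sum_eq_zero_iff_of_nonneg fun j _ => div_nonneg (sq_nonneg _)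
    (mul_pos (hs.pos j) (ht.pos j)).le).mp hsum i (Finset.mem_univ i)
  rcases div_eq_zero_iff.mp h0 with h | h
  · exact (sub_eq_zero.mp (pow_eq_zero_iff two_ne_zero |>.mp h)).symm
  · exact absurd h (mul_pos (hs.pos i) (ht.pos i)).ne'

theorem IsVectorMultiplier.inner_vectorMultiplier {n : ℕ} {w : Fin n → E} {t : E}
    (ht : IsVectorMultiplier w t) (i : Fin n) :
    inner ℝ (vectorMultiplier w) (w i) = inner ℝ t (w i) :=
  (isVectorMultiplier_vectorMultiplier ⟨t, ht⟩).inner_eq ht i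

theorem inner_vectorMultiplier_gt {n : ℕ} (w : Fin n → E) (i : Fin n) :
    0 < 1 + inner ℝ (vectorMultiplier w) (w i) := by
  by_cases h : ∃ t, IsVectorMultiplier w t
  · exact (isVectorMultiplier_vectorMultiplier h).pos i
  · simp [vectorMultiplier_eq_zero h]

/-- The multiplier equation tested against the multiplier itself. -/
theorem sum_inner_div_eq_zero {n : ℕ} (w : Fin n → E) :
    ∑ i, inner ℝ (vectorMultiplier w) (w i) / (1 + inner ℝ (vectorMultiplier w) (w i)) = 0 := by
  by_cases h : ∃ t, IsVectorMultiplier w t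
  · have h1 := congrArg (fun u => inner ℝ (vectorMultiplier w) u)
      (isVectorMultiplier_vectorMultiplier h).sum_eq_zero
    simp only [inner_sum, real_inner_smul_right, inner_zero_right] at h1
    rw [← h1]
    exact Finset.sum_congr rfl fun i _ => by ring
  · simp [vectorMultiplier_eq_zero h]

variable [FiniteDimensional ℝ E] [MeasurableSpace E] [BorelSpace E]

/-- A statistic which is a sum of continuous functions of the inner products `tᵀwᵢ` is a measurable
function of the vectors `wᵢ`. -/
theorem measurable_sum_inner_vectorMultiplier {f : ℝ → ℝ} (hf : ContinuousOn f (Set.Ioi (-1)))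
    (hf0 : f 0 = 0) (n : ℕ) :
    Measurable fun w : Fin n → E => ∑ i, f (inner ℝ (vectorMultiplier w) (w i)) := by
  -- The bound `1/n`, unlike mere positivity, is a closed condition, and it keeps the denominators
  -- away from zero.
  set D : Set ((Fin n → E) × E) := {p | ∀ i, 1 / (n : ℝ) ≤ 1 + inner ℝ p.2 (p.1 i)} with hD
  have hDclosed : IsClosed D := by
    rw [hD, Set.ofPred_forall]
    exact isClosed_iInter fun i => isClosed_le (by fun_prop) (by fun_prop)
  have hDpos : ∀ p ∈ D, ∀ i, 0 < 1 + inner ℝ p.2 (p.1 i) := fun p hp i => by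
    have hn : (0 : ℝ) < n := by exact_mod_cast i.pos
    exact lt_of_lt_of_le (by positivity) (hp i)
  have hG : ContinuousOn (fun p : (Fin n → E) × E =>
      (1 / (n : ℝ)) • ∑ i, (1 / (1 + inner ℝ p.2 (p.1 i))) • p.1 i) D := by
    refine ContinuousOn.const_smul (continuousOn_finsetSum _ fun i _ => ?_) _
    refine ContinuousOn.smul (ContinuousOn.div continuousOn_const (by fun_prop) ?_) (by fun_prop)
    exact fun p hp => (hDpos p hp i).ne'
  have hF : ContinuousOn (fun p : (Fin n → E) × E => ∑ i, f (inner ℝ p.2 (p.1 i))) D := by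
    refine continuousOn_finsetSum _ fun i _ => hf.comp (by fun_prop) fun p hp => ?_
    have := hDpos p hp i
    simp only [Set.mem_Ioi]; linarith
  set K : Set ℝ → Set ((Fin n → E) × E) := fun C =>
    {p | IsVectorMultiplier p.1 p.2 ∧ ∑ i, f (inner ℝ p.2 (p.1 i)) ∈ C} with hK
  have hKclosed : ∀ C, IsClosed C → IsClosed (K C) := fun C hC => by
    have h1 := (hG.prodMk hF).preimage_isClosed_of_isClosed hDclosed
      ((isClosed_singleton (x := (0 : E))).prod hC)
    convert h1 using 1
    ext p
    simp only [hK, hD, IsVectorMultiplier, Set.mem_ofPred_eq, Set.mem_inter_iff, Set.mem_preimage,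
      Set.mem_prod, Set.mem_singleton_iff, and_assoc]
  -- The choice of `t` carries no measurability, so `t` is projected out: `E` is a countable union
  -- of compact balls, and projecting a closed set along a compact factor is closed.
  have hproj : ∀ C, IsClosed C → MeasurableSet {w : Fin n → E | ∃ t, (w, t) ∈ K C} :=
    fun C hC => by
    have hU : {w : Fin n → E | ∃ t, (w, t) ∈ K C} =
        ⋃ N : ℕ, {w | ∃ t ∈ Metric.closedBall (0 : E) N, (w, t) ∈ K C} := by
      ext w
      simp only [Set.mem_ofPred_eq, Set.mem_iUnion]
      constructor
      · rintro ⟨t, ht⟩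
        obtain ⟨N, hN⟩ := exists_nat_ge ‖t‖
        exact ⟨N, t, by simpa using hN, ht⟩
      · rintro ⟨N, t, -, ht⟩
        exact ⟨t, ht⟩
    rw [hU]
    refine MeasurableSet.iUnion fun N => IsClosed.measurableSet ?_
    have hcpt : CompactSpace (Metric.closedBall (0 : E) N) :=
      isCompact_iff_compactSpace.mp (isCompact_closedBall _ _)
    have h2 : IsClosed {p : (Fin n → E) × Metric.closedBall (0 : E) N | (p.1, (p.2 : E)) ∈ K C} :=
      (hKclosed C hC).preimage (by fun_prop)
    convert isClosedMap_fst_of_compactSpace _ h2 using 1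
    ext w
    simp
  refine measurable_of_isClosed fun C hC => ?_
  have hex : {w : Fin n → E | ∃ t, (w, t) ∈ K Set.univ} =
      {w : Fin n → E | ∃ t, IsVectorMultiplier w t} := by
    ext w; simp [hK]
  -- Any multiplier gives the same value, so membership in the preimage may be tested on an
  -- arbitrary one. Samples without a multiplier have value `0`, because `f 0 = 0`.
  have hpre : (fun w : Fin n → E => ∑ i, f (inner ℝ (vectorMultiplier w) (w i))) ⁻¹' C =
      {w | ∃ t, (w, t) ∈ K C} ∪ ({w | ∃ t, (w, t) ∈ K Set.univ}ᶜ ∩ {_w | (0 : ℝ) ∈ C}) := by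
    rw [hex]
    ext w
    simp only [Set.mem_preimage, Set.mem_union, Set.mem_ofPred_eq, Set.mem_inter_iff,
      Set.mem_compl_iff, hK]
    by_cases h : ∃ t, IsVectorMultiplier w t
    · constructor
      · exact fun hw => Or.inl ⟨_, isVectorMultiplier_vectorMultiplier h, hw⟩
      · rintro (⟨t, ht, hw⟩ | ⟨hn, -⟩)
        · simpa only [ht.inner_vectorMultiplier] using hw
        · exact absurd h hn
    · rw [vectorMultiplier_eq_zero h]
      simp only [inner_zero_left, hf0, Finset.sum_const_zero, h, not_false_eq_true, true_and]
      constructor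
      · exact Or.inr
      · rintro (⟨t, ht, -⟩ | h')
        · exact absurd ⟨t, ht⟩ h
        · exact h'
  rw [hpre]
  exact (hproj C hC).union ((hproj _ isClosed_univ).compl.inter (MeasurableSet.const _))

end Multiplier

/-! ### Divergence statistics as sums over the sample -/

section Divergence

/-- The function `a ↦ (2 / φ''(1)) φ(1 + a) / (1 + a)`, in terms of which the `φ`-divergence
statistic is a sum over the sample. -/
noncomputable def divergenceKernel (φ : ℝ → ℝ) (a : ℝ) : ℝ :=
  2 / deriv (deriv φ) 1 * (φ (1 + a) / (1 + a))

/-- With `a = tᵀgᵢ`, the ratio of the uniform weight to `pᵢ` is `1 + a`, and the prefactor `n`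
cancels the `1/n` in `pᵢ`. -/
theorem phiStatistic_eq_sum {q n : ℕ} (φ : ℝ → ℝ) (x : Fin n → EuclideanSpace ℝ (Fin q))
    (y : Fin n → ℝ) (β : EuclideanSpace ℝ (Fin q)) :
    phiStatistic φ x y β = ∑ i, divergenceKernel φ
      (inner ℝ (vectorMultiplier fun i => score (x i) (y i) β) (score (x i) (y i) β)) := by
  rw [phiStatistic, phiDivergence, Finset.mul_sum]
  refine Finset.sum_congr rfl fun i _ => ?_
  have hn : (n : ℝ) ≠ 0 := by exact_mod_cast i.pos.ne'
  rw [weights, uniformWeights, multiplier_eq_vectorMultiplier, divergenceKernel]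
  have hp := (inner_vectorMultiplier_gt (fun i => score (x i) (y i) β) i).ne'
  set a := inner ℝ (vectorMultiplier fun i => score (x i) (y i) β) (score (x i) (y i) β)
  have h1 : 1 / (n : ℝ) / (1 / (n : ℝ) * (1 / (1 + a))) = 1 + a := by field_simp
  rw [h1]
  field_simp

theorem IsDivergenceFunction.divergenceKernel_zero {φ : ℝ → ℝ} (hφ : IsDivergenceFunction φ) :
    divergenceKernel φ 0 = 0 := by
  simp [divergenceKernel, hφ.map_one]

theorem IsDivergenceFunction.continuousOn_divergenceKernel {φ : ℝ → ℝ}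
    (hφ : IsDivergenceFunction φ) : ContinuousOn (divergenceKernel φ) (Set.Ioi (-1)) := by
  have h1 : ∀ a ∈ Set.Ioi (-1 : ℝ), (1 + a) ∈ Set.Ioi (0 : ℝ) := fun a ha => by
    simp only [Set.mem_Ioi] at *; linarith
  refine ContinuousOn.mul continuousOn_const (ContinuousOn.div ?_ (by fun_prop) ?_)
  · exact hφ.differentiableOn.continuousOn.comp (by fun_prop) h1
  · exact fun a ha => (h1 a ha).ne'

/-- Since `φ''` need not be continuous, l'Hôpital is used only once; the remaining quotient is half
the slope of `φ'` at `1`. -/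
theorem IsDivergenceFunction.tendsto_div_sq {φ : ℝ → ℝ} (hφ : IsDivergenceFunction φ) :
    Tendsto (fun x => φ x / (x - 1) ^ 2) (𝓝[≠] 1) (𝓝 (deriv (deriv φ) 1 / 2)) := by
  have hmem : Set.Ioi (0 : ℝ) ∈ 𝓝 (1 : ℝ) := Ioi_mem_nhds one_pos
  refine HasDerivAt.lhopital_zero_nhdsNE (f' := deriv φ) (g' := fun x => 2 * (x - 1)) ?_ ?_ ?_ ?_
    ?_ ?_
  · refine eventually_nhdsWithin_of_eventually_nhds ?_
    filter_upwards [hmem] with x hx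
    exact (hφ.differentiableOn.differentiableAt (Ioi_mem_nhds hx)).hasDerivAt
  · refine Eventually.of_forall fun x => ?_
    simpa using ((hasDerivAt_id x).sub_const 1).fun_pow 2
  · filter_upwards [self_mem_nhdsWithin] with x hx
    exact mul_ne_zero two_ne_zero (sub_ne_zero.mpr hx)
  · have := (hφ.differentiableOn.differentiableAt hmem).continuousAt.tendsto
    rw [hφ.map_one] at this
    exact this.mono_left nhdsWithin_le_nhds
  · have : ContinuousAt (fun x : ℝ => (x - 1) ^ 2) 1 := by fun_prop
    have h := this.tendsto
    simp only [sub_self, ne_eq, OfNat.ofNat_ne_zero, not_false_eq_true, zero_pow] at h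
    exact h.mono_left nhdsWithin_le_nhds
  · have h := hasDerivAt_iff_tendsto_slope.mp
      (hφ.differentiableOn_deriv.differentiableAt hmem).hasDerivAt
    refine (h.div_const 2).congr fun x => ?_
    rw [slope_def_field, hφ.deriv_one, sub_zero, div_div, mul_comm]

/-- `(2 / φ''(1)) φ(1 + a) / (1 + a) = a² + o(a²)` as `a → 0`. -/
theorem IsDivergenceFunction.abs_divergenceKernel_sub_le {φ : ℝ → ℝ}
    (hφ : IsDivergenceFunction φ) {κ : ℝ} (hκ : 0 < κ) :
    ∃ η > 0, ∀ a, |a| ≤ η → |divergenceKernel φ a - a ^ 2| ≤ κ * a ^ 2 := by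
  have hc := hφ.deriv_deriv_one.ne'
  have hmap : Tendsto (fun a : ℝ => 1 + a) (𝓝[≠] 0) (𝓝[≠] 1) := by
    refine tendsto_nhdsWithin_iff.mpr ⟨?_, ?_⟩
    · have : ContinuousAt (fun a : ℝ => 1 + a) 0 := by fun_prop
      simpa using this.tendsto.mono_left nhdsWithin_le_nhds
    · filter_upwards [self_mem_nhdsWithin] with a ha
      simpa using ha
  have hlim : Tendsto (fun a => divergenceKernel φ a / a ^ 2) (𝓝[≠] 0) (𝓝 1) := by
    have h1 := (hφ.tendsto_div_sq.comp hmap).const_mul (2 / deriv (deriv φ) 1)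
    have h2 : Tendsto (fun a : ℝ => (1 + a)⁻¹) (𝓝[≠] 0) (𝓝 1) := by
      have : ContinuousAt (fun a : ℝ => (1 + a)⁻¹) 0 :=
        ContinuousAt.inv₀ (by fun_prop) (by norm_num)
      simpa using this.tendsto.mono_left nhdsWithin_le_nhds
    have h3 := h1.mul h2
    have h4 : 2 / deriv (deriv φ) 1 * (deriv (deriv φ) 1 / 2) * 1 = 1 := by field_simp
    rw [h4] at h3
    refine h3.congr fun a => ?_
    simp only [Function.comp_apply, add_sub_cancel_left, divergenceKernel]
    ring
  rw [Metric.tendsto_nhdsWithin_nhds] at hlim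
  obtain ⟨η, hη, h⟩ := hlim κ hκ
  refine ⟨η / 2, by positivity, fun a ha => ?_⟩
  rcases eq_or_ne a 0 with rfl | ha0
  · simp [hφ.divergenceKernel_zero]
  · have h1 := h ha0 (by rw [Real.dist_eq, sub_zero]; linarith)
    rw [Real.dist_eq] at h1
    have h2 : 0 < a ^ 2 := by positivity
    have h3 : divergenceKernel φ a - a ^ 2 = (divergenceKernel φ a / a ^ 2 - 1) * a ^ 2 := by
      field_simp
    rw [h3, abs_mul, abs_of_pos h2]
    gcongr

/-- The divergence function of the reversed Kullback-Leibler divergence. -/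
noncomputable def entropyFunction (x : ℝ) : ℝ := x * Real.log x - x + 1

theorem deriv_entropyFunction {x : ℝ} (hx : x ≠ 0) : deriv entropyFunction x = Real.log x := by
  have h := ((Real.hasDerivAt_mul_log hx).sub (hasDerivAt_id x)).add_const 1
  have h' : HasDerivAt entropyFunction (Real.log x + 1 - 1) x := h
  rw [h'.deriv]; ring

theorem deriv_deriv_entropyFunction_one : deriv (deriv entropyFunction) 1 = 1 := by
  have h : deriv entropyFunction =ᶠ[𝓝 1] Real.log := by
    filter_upwards [isOpen_ne.mem_nhds (one_ne_zero (α := ℝ))] with x hx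
    exact deriv_entropyFunction hx
  rw [h.deriv_eq, Real.deriv_log]; norm_num

theorem isDivergenceFunction_entropyFunction : IsDivergenceFunction entropyFunction where
  differentiableOn := by
    intro x hx
    have hx' : x ≠ 0 := (Set.mem_Ioi.mp hx).ne'
    have h := ((Real.hasDerivAt_mul_log hx').sub (hasDerivAt_id x)).add_const 1
    exact h.differentiableAt.differentiableWithinAt
  differentiableOn_deriv := by
    refine DifferentiableOn.congr (f := Real.log) (fun x hx => ?_) fun x hx => ?_
    · exact (Real.differentiableAt_log (Set.mem_Ioi.mp hx).ne').differentiableWithinAt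
    · exact deriv_entropyFunction (Set.mem_Ioi.mp hx).ne'
  convexOn := by
    have h1 : ConvexOn ℝ (Set.Ioi 0) fun x : ℝ => x * Real.log x :=
      Real.convexOn_mul_log.subset Set.Ioi_subset_Ici_self (convex_Ioi 0)
    have h2 : ConvexOn ℝ (Set.Ioi 0) fun x : ℝ => -x + 1 :=
      (concaveOn_id (convex_Ioi 0)).neg.add_const 1
    refine (h1.add h2).congr fun x _ => ?_
    change x * Real.log x + (-x + 1) = x * Real.log x - x + 1
    ring
  map_one := by simp [entropyFunction]
  deriv_one := by rw [deriv_entropyFunction one_ne_zero, Real.log_one]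
  deriv_deriv_one := by rw [deriv_deriv_entropyFunction_one]; exact one_pos

/-- The empirical likelihood ratio statistic is a `φ`-divergence statistic. -/
theorem likelihoodRatioStatistic_eq_phiStatistic {q n : ℕ}
    (x : Fin n → EuclideanSpace ℝ (Fin q)) (y : Fin n → ℝ) (β : EuclideanSpace ℝ (Fin q)) :
    likelihoodRatioStatistic x y β = phiStatistic entropyFunction x y β := by
  rw [phiStatistic_eq_sum, likelihoodRatioStatistic, logLikelihood, multiplier_eq_vectorMultiplier]
  set w : Fin n → EuclideanSpace ℝ (Fin q) := fun i => score (x i) (y i) β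
  have hw : ∀ i, score (x i) (y i) β = w i := fun _ => rfl
  simp only [hw]
  -- The correction `2a/(1 + a)` sums to zero by the multiplier equation paired with the multiplier,
  -- so the identity is exact on every sample.
  have h : ∀ i, divergenceKernel entropyFunction (inner ℝ (vectorMultiplier w) (w i)) =
      2 * Real.log (1 + inner ℝ (vectorMultiplier w) (w i)) -
        2 * (inner ℝ (vectorMultiplier w) (w i) /
          (1 + inner ℝ (vectorMultiplier w) (w i))) := fun i => by
    have hp := (inner_vectorMultiplier_gt w i).ne'
    rw [divergenceKernel, deriv_deriv_entropyFunction_one, entropyFunction]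
    field_simp
    ring
  simp only [h]
  rw [Finset.sum_sub_distrib, ← Finset.mul_sum, ← Finset.mul_sum, sum_inner_div_eq_zero]
  ring

end Divergence

/-! ### Probabilistic limit theorems for i.i.d. vectors -/

section Limits

variable {q : ℕ} {Ω : Type*} [MeasurableSpace Ω] {P : Measure Ω} [IsProbabilityMeasure P]
  {W : ℕ → Ω → EuclideanSpace ℝ (Fin q)}

/-- The limit law in the multivariate central limit theorem, realized by i.i.d. coordinates. -/
theorem charFun_map_toLp_pi_gaussianReal (t : EuclideanSpace ℝ (Fin q)) :
    charFun ((Measure.pi fun _ : Fin q => gaussianReal 0 1).map (WithLp.toLp 2)) t =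
      Complex.exp (-‖t‖ ^ 2 / 2) := by
  rw [map_pi_eq_stdGaussian, charFun_stdGaussian]

/-- The Cramér–Wold device: it reduces the multivariate limit theorem to the scalar one for each
projection. -/
theorem charFun_map_eq_charFun_map_inner {P : Measure Ω} {Y : Ω → EuclideanSpace ℝ (Fin q)}
    (hY : AEMeasurable Y P) (t : EuclideanSpace ℝ (Fin q)) :
    charFun (P.map Y) t = charFun (P.map fun ω => (inner ℝ (Y ω) t : ℝ)) 1 := by
  rw [charFun_apply, charFun_apply_real, integral_map hY (by fun_prop),
    integral_map (by fun_prop) (by fun_prop)]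
  simp

/-- Multivariate central limit theorem for standardized i.i.d. vectors. -/
theorem tendstoInDistribution_inv_sqrt_smul_sum (hindep : iIndepFun W P)
    (hident : ∀ i, IdentDistrib (W i) (W 0) P P) (hL2 : MemLp (W 0) 2 P) (hmean : P[W 0] = 0)
    (hcov : ∀ u, ∫ ω, (inner ℝ (W 0 ω) u : ℝ) ^ 2 ∂P = ‖u‖ ^ 2) :
    TendstoInDistribution (fun (n : ℕ) ω => (√(n : ℝ))⁻¹ • ∑ k ∈ Finset.range n, W k ω) atTop
      (WithLp.toLp 2) (fun _ => P) (Measure.pi fun _ : Fin q => gaussianReal 0 1) where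
  forall_aemeasurable n := AEMeasurable.const_smul
    (Finset.aemeasurable_fun_sum (Finset.range n) fun k _ => (hident k).aemeasurable_fst)
    (√(n : ℝ))⁻¹
  tendsto := by
    have hmeas : ∀ n : ℕ, AEMeasurable (fun ω => (√(n : ℝ))⁻¹ • ∑ k ∈ Finset.range n, W k ω) P :=
      fun n => AEMeasurable.const_smul
        (Finset.aemeasurable_fun_sum (Finset.range n) fun k _ => (hident k).aemeasurable_fst)
        (√(n : ℝ))⁻¹
    refine ProbabilityMeasure.tendsto_iff_tendsto_charFun.2 fun t => ?_
    simp only [ProbabilityMeasure.coe_mk]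
    rw [charFun_map_toLp_pi_gaussianReal]
    have hint : Integrable (W 0) P := hL2.integrable (by norm_num)
    have hL2t : MemLp (fun ω => (inner ℝ (W 0 ω) t : ℝ)) 2 P := hL2.inner_const t
    have hmean_t : ∫ ω, (inner ℝ (W 0 ω) t : ℝ) ∂P = 0 := by
      have := integral_inner (𝕜 := ℝ) hint t
      simp only [hmean, inner_zero_right] at this
      rw [← this]
      exact integral_congr_ae (Eventually.of_forall fun ω => real_inner_comm _ _)
    have hvar : Var[fun ω => (inner ℝ (W 0 ω) t : ℝ); P] = ‖t‖ ^ 2 := by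
      rw [variance_of_integral_eq_zero hL2t.aestronglyMeasurable.aemeasurable hmean_t, hcov]
    have hclt := tendstoInDistribution_inv_sqrt_mul_sum_sub (P := P)
      (X := fun i ω => (inner ℝ (W i ω) t : ℝ)) (Y := id)
      (P' := gaussianReal 0 (Var[fun ω => (inner ℝ (W 0 ω) t : ℝ); P]).toNNReal)
      ⟨aemeasurable_id, Measure.map_id⟩ hL2t
      (hindep.comp (fun _ u => (inner ℝ u t : ℝ)) fun _ => by fun_prop)
      fun i => (hident i).comp (u := fun u => (inner ℝ u t : ℝ)) (by fun_prop)
    have h1 := ProbabilityMeasure.tendsto_iff_tendsto_charFun.1 hclt.tendsto 1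
    simp only [ProbabilityMeasure.coe_mk, Measure.map_id, charFun_gaussianReal, hvar, hmean_t,
      mul_zero, sub_zero] at h1
    have h2 : Complex.exp (-‖t‖ ^ 2 / 2) = Complex.exp ((1 : ℝ) * (0 : ℝ) * Complex.I -
        ((‖t‖ ^ 2).toNNReal : ℝ) * (1 : ℝ) ^ 2 / 2) := by
      rw [Real.coe_toNNReal _ (by positivity)]
      congr 1
      push_cast
      ring
    rw [h2]
    refine h1.congr fun n => ?_
    rw [charFun_map_eq_charFun_map_inner (hmeas n)]
    simp only [real_inner_smul_left, sum_inner]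

/-- The normalized sums are bounded in probability. -/
theorem exists_measure_norm_gt_le {Z : ℕ → Ω → EuclideanSpace ℝ (Fin q)}
    {Ω' : Type*} [MeasurableSpace Ω'] {P' : Measure Ω'} [IsProbabilityMeasure P']
    {Z' : Ω' → EuclideanSpace ℝ (Fin q)}
    (hZ : TendstoInDistribution Z atTop Z' (fun _ => P) P') {ρ : ENNReal} (hρ : 0 < ρ) :
    ∃ M : ℝ, 0 < M ∧ ∀ n, P {ω | M < ‖Z n ω‖} ≤ ρ := by
  have hprob : ∀ n, IsProbabilityMeasure (P.map (Z n)) := fun n =>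
    Measure.isProbabilityMeasure_map (hZ.forall_aemeasurable n)
  have hprob' : IsProbabilityMeasure (P'.map Z') :=
    Measure.isProbabilityMeasure_map hZ.aemeasurable_limit
  -- Pointwise convergence of characteristic functions to a continuous limit gives tightness of the
  -- whole sequence, hence one `M` for all `n`.
  have htight : IsTightMeasureSet (Set.range fun n => P.map (Z n)) :=
    isTightMeasureSet_of_tendsto_charFun (f := charFun (P'.map Z')) (by fun_prop)
      fun t => ProbabilityMeasure.tendsto_iff_tendsto_charFun.1 hZ.tendsto t
  have h := tendsto_measure_norm_gt_of_isTightMeasureSet htight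
  obtain ⟨M, hM, hM0⟩ := ((h.eventually_le_const hρ).and (eventually_gt_atTop 0)).exists
  refine ⟨M, hM0, fun n => ?_⟩
  have h1 : (P.map (Z n)) {x | M < ‖x‖} ≤ ρ :=
    (le_iSup₂ (f := fun (μ : Measure (EuclideanSpace ℝ (Fin q)))
      (_ : μ ∈ Set.range fun n => P.map (Z n)) => μ {x | M < ‖x‖}) _ ⟨n, rfl⟩).trans hM
  rwa [Measure.map_apply_of_aemeasurable (hZ.forall_aemeasurable n)
    (measurableSet_lt measurable_const measurable_norm)] at h1

/-- The maximum of i.i.d. vectors with a finite third moment is `o(√n)` in probability. -/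
theorem tendsto_measure_exists_norm_gt (hident : ∀ i, IdentDistrib (W i) (W 0) P P)
    (hL3 : Integrable (fun ω => ‖W 0 ω‖ ^ 3) P) {δ : ℝ} (hδ : 0 < δ) :
    Tendsto (fun n : ℕ => P {ω | ∃ i : Fin n, δ * √(n : ℝ) < ‖W i ω‖}) atTop (𝓝 0) := by
  set C := ∫ ω, ‖W 0 ω‖ ^ 3 ∂P with hC
  have hbound : ∀ᶠ n : ℕ in atTop, P {ω | ∃ i : Fin n, δ * √(n : ℝ) < ‖W i ω‖} ≤
      ENNReal.ofReal (C / δ ^ 3 * (√(n : ℝ))⁻¹) := by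
    filter_upwards [eventually_gt_atTop 0] with n hn
    have hn' : (0 : ℝ) < n := by exact_mod_cast hn
    have hs : 0 < √(n : ℝ) := Real.sqrt_pos.mpr hn'
    -- Markov's inequality for the cube gives order `n^(-3/2)` per index, so the union bound over
    -- `n` indices is of order `n^(-1/2)`.
    have h1 : ∀ i : Fin n, P {ω | δ * √(n : ℝ) < ‖W i ω‖} ≤
        ENNReal.ofReal (C / (δ * √(n : ℝ)) ^ 3) := fun i => by
      have hid := (hident i).comp (u := fun u => ‖u‖) (by fun_prop)
      have h2 : P {ω | δ * √(n : ℝ) < ‖W i ω‖} = P {ω | δ * √(n : ℝ) < ‖W 0 ω‖} :=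
        hid.measure_mem_eq measurableSet_Ioi
      have h3 := mul_meas_ge_le_integral_of_nonneg (μ := P)
        (Eventually.of_forall fun ω => pow_nonneg (norm_nonneg (W 0 ω)) 3) hL3 ((δ * √(n : ℝ)) ^ 3)
      have h4 : P.real {ω | δ * √(n : ℝ) < ‖W 0 ω‖} ≤ C / (δ * √(n : ℝ)) ^ 3 := by
        rw [le_div_iff₀ (by positivity), mul_comm]
        refine le_trans ?_ h3
        refine mul_le_mul_of_nonneg_left (measureReal_mono fun ω hω => ?_) (by positivity)
        have hω' : δ * √(n : ℝ) < ‖W 0 ω‖ := hω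
        exact pow_le_pow_left₀ (by positivity : 0 ≤ δ * √(n : ℝ)) hω'.le 3
      rw [h2, ← ofReal_measureReal]
      exact ENNReal.ofReal_le_ofReal h4
    have h5 : {ω | ∃ i : Fin n, δ * √(n : ℝ) < ‖W i ω‖} =
        ⋃ i : Fin n, {ω | δ * √(n : ℝ) < ‖W i ω‖} := by
      ext ω; simp
    rw [h5]
    calc _ ≤ ∑ i : Fin n, P {ω | δ * √(n : ℝ) < ‖W i ω‖} := measure_iUnion_fintype_le _ _
      _ ≤ ∑ _i : Fin n, ENNReal.ofReal (C / (δ * √(n : ℝ)) ^ 3) :=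
          Finset.sum_le_sum fun i _ => h1 i
      _ = ENNReal.ofReal (n * (C / (δ * √(n : ℝ)) ^ 3)) := by
          rw [Finset.sum_const, Finset.card_univ, Fintype.card_fin, nsmul_eq_mul,
            ENNReal.ofReal_mul hn'.le, ENNReal.ofReal_natCast]
      _ = _ := by
          congr 1
          have h6 : (n : ℝ) = √(n : ℝ) ^ 2 := (Real.sq_sqrt hn'.le).symm
          nth_rewrite 1 [h6]
          field_simp
  refine tendsto_of_tendsto_of_tendsto_of_le_of_le' tendsto_const_nhds ?_
    (Eventually.of_forall fun _ => zero_le) hbound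
  have h7 : Tendsto (fun n : ℕ => C / δ ^ 3 * (√(n : ℝ))⁻¹) atTop (𝓝 0) := by
    simpa using (tendsto_inv_atTop_zero.comp
      (Real.tendsto_sqrt_atTop.comp tendsto_natCast_atTop_atTop)).const_mul (C / δ ^ 3)
  simpa [Function.comp_def] using (ENNReal.continuous_ofReal.tendsto 0).comp h7

/-- Weak law of large numbers for the empirical second moment operator. -/
theorem tendsto_measure_norm_sum_rankOne_sub_gt (hindep : iIndepFun W P)
    (hident : ∀ i, IdentDistrib (W i) (W 0) P P) (hL2 : MemLp (W 0) 2 P)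
    (hcov : ∀ u v, ∫ ω, (inner ℝ (W 0 ω) u : ℝ) * inner ℝ (W 0 ω) v ∂P = inner ℝ u v) {δ : ℝ}
    (hδ : 0 < δ) :
    Tendsto (fun n : ℕ => P {ω | δ < ‖(n : ℝ)⁻¹ • ∑ k ∈ Finset.range n,
      InnerProductSpace.rankOne ℝ (W k ω) (W k ω) -
        ContinuousLinearMap.id ℝ (EuclideanSpace ℝ (Fin q))‖}) atTop (𝓝 0) := by
  set φ : EuclideanSpace ℝ (Fin q) → EuclideanSpace ℝ (Fin q) →L[ℝ] EuclideanSpace ℝ (Fin q) :=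
    fun w => InnerProductSpace.rankOne ℝ w w with hφdef
  have hφ : Continuous φ :=
    (InnerProductSpace.rankOne ℝ).continuous.clm_apply continuous_id
  have hmeas : AEStronglyMeasurable (W 0) P := hL2.aestronglyMeasurable
  have hint : Integrable (fun ω => φ (W 0 ω)) P := by
    have h1 : Integrable (fun ω => ‖W 0 ω‖ ^ 2) P := hL2.integrable_norm_pow (by norm_num)
    refine h1.mono (hφ.comp_aestronglyMeasurable hmeas) (Eventually.of_forall fun ω => ?_)
    simp [hφdef, pow_two]
  have hmean : ∫ ω, φ (W 0 ω) ∂P = ContinuousLinearMap.id ℝ _ := by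
    ext1 u
    rw [ContinuousLinearMap.integral_apply hint]
    refine ext_inner_right ℝ fun v => ?_
    have h2 : Integrable (fun ω => φ (W 0 ω) u) P := hint.apply_continuousLinearMap u
    rw [real_inner_comm, ← integral_inner h2 v, ContinuousLinearMap.id_apply, ← hcov]
    refine integral_congr_ae (Eventually.of_forall fun ω => ?_)
    simp only [hφdef, InnerProductSpace.rankOne_apply, real_inner_smul_right]
    rw [real_inner_comm v]
  -- The strong law in the Banach space of operators gives convergence in operator norm directly.
  have hlln := strong_law_ae (fun i ω => φ (W i ω)) hint
    (fun i j hij => (hindep.indepFun hij).comp hφ.measurable hφ.measurable)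
    fun i => (hident i).comp hφ.measurable
  have hm : ∀ n : ℕ, AEStronglyMeasurable
      (fun ω => (n : ℝ)⁻¹ • ∑ k ∈ Finset.range n, φ (W k ω)) P := fun n =>
    AEStronglyMeasurable.const_smul (Finset.aestronglyMeasurable_fun_sum (Finset.range n)
      fun k _ => hφ.comp_aestronglyMeasurable ((hident k).aestronglyMeasurable_iff.2 hmeas))
      (n : ℝ)⁻¹
  have h3 := tendstoInMeasure_iff_norm.1 (tendstoInMeasure_of_tendsto_ae hm hlln) δ hδ
  refine tendsto_of_tendsto_of_tendsto_of_le_of_le tendsto_const_nhds h3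
    (fun _ => zero_le) fun n => measure_mono fun ω hω => ?_
  simp only [hmean, Set.mem_ofPred_eq] at hω ⊢
  exact hω.le

end Limits

/-! ### Standardization of the second moment matrix -/

section Whitening

variable {q : ℕ}

theorem inner_toEuclideanCLM (S : Matrix (Fin q) (Fin q) ℝ) (a b : EuclideanSpace ℝ (Fin q)) :
    inner ℝ a (Matrix.toEuclideanCLM (𝕜 := ℝ) S b) = ∑ j, ∑ k, a j * b k * S j k := by
  simp only [PiLp.inner_apply, Matrix.ofLp_toEuclideanCLM, Matrix.mulVec, dotProduct,
    RCLike.inner_apply, conj_trivial, Finset.sum_mul]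
  exact Finset.sum_congr rfl fun j _ => Finset.sum_congr rfl fun k _ => by ring

theorem integral_inner_mul_inner {α : Type*} [MeasurableSpace α] {μ : Measure α}
    {g : α → EuclideanSpace ℝ (Fin q)} (hint : ∀ j k, Integrable (fun z => g z j * g z k) μ)
    (a b : EuclideanSpace ℝ (Fin q)) :
    ∫ z, (inner ℝ (g z) a : ℝ) * inner ℝ (g z) b ∂μ =
      inner ℝ a (Matrix.toEuclideanCLM (𝕜 := ℝ)
        (Matrix.of fun j k => ∫ z, g z j * g z k ∂μ) b) := by
  rw [inner_toEuclideanCLM]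
  have h : ∀ z, (inner ℝ (g z) a : ℝ) * inner ℝ (g z) b =
      ∑ j, ∑ k, a j * b k * (g z j * g z k) := fun z => by
    simp only [PiLp.inner_apply, RCLike.inner_apply, conj_trivial, Finset.sum_mul_sum]
    exact Finset.sum_congr rfl fun j _ => Finset.sum_congr rfl fun k _ => by ring
  simp only [h]
  rw [integral_finsetSum _ fun j _ => integrable_finsetSum _ fun k _ => (hint j k).const_mul _]
  refine Finset.sum_congr rfl fun j _ => ?_
  rw [integral_finsetSum _ fun k _ => (hint j k).const_mul _]
  exact Finset.sum_congr rfl fun k _ => by rw [integral_const_mul, Matrix.of_apply]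

open scoped MatrixOrder in
/-- A random vector with a nondegenerate second moment matrix can be standardized. -/
theorem exists_injective_standardization {α : Type*} [MeasurableSpace α] {μ : Measure α}
    {g : α → EuclideanSpace ℝ (Fin q)} (hint : ∀ j k, Integrable (fun z => g z j * g z k) μ)
    (hpos : (Matrix.of fun j k : Fin q => ∫ z, g z j * g z k ∂μ).PosDef) :
    ∃ A : EuclideanSpace ℝ (Fin q) →L[ℝ] EuclideanSpace ℝ (Fin q), Function.Injective A ∧
      ∀ u v, ∫ z, (inner ℝ (A (g z)) u : ℝ) * inner ℝ (A (g z)) v ∂μ = inner ℝ u v := by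
  set S : Matrix (Fin q) (Fin q) ℝ := Matrix.of fun j k => ∫ z, g z j * g z k ∂μ with hS
  -- With `S = BᵀB`, the map `A = (B⁻¹)ᵀ` standardizes, as `(B⁻¹)ᵀ S B⁻¹ = 1`.
  obtain ⟨B, hB⟩ := CStarAlgebra.nonneg_iff_eq_star_mul_self.mp hpos.posSemidef.nonneg
  have hdet : IsUnit B.det := by
    have h := hpos.det_pos.ne'
    rw [hB, Matrix.det_mul] at h
    exact (right_ne_zero_of_mul h).isUnit
  let T := Matrix.toEuclideanCLM (n := Fin q) (𝕜 := ℝ)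
  have hinv : ∀ C D : Matrix (Fin q) (Fin q) ℝ, C * D = 1 → ∀ u, T C (T D u) = u :=
    fun C D h u => by
    change (T C * T D) u = u
    rw [← map_mul, h, map_one]
    rfl
  have hTB := hinv _ _ (Matrix.mul_nonsing_inv B hdet)
  refine ⟨ContinuousLinearMap.adjoint (T B⁻¹), ?_, fun u v => ?_⟩
  · refine (injective_iff_map_eq_zero _).mpr fun w hw => ext_inner_right ℝ fun u => ?_
    rw [← hinv _ _ (Matrix.nonsing_inv_mul B hdet) u,
      ← ContinuousLinearMap.adjoint_inner_left, hw, inner_zero_left, inner_zero_left]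
  · simp only [ContinuousLinearMap.adjoint_inner_left]
    rw [integral_inner_mul_inner hint, ← hS]
    have h1 : Matrix.toEuclideanCLM (𝕜 := ℝ) S =
        ContinuousLinearMap.adjoint (T B) * T B := by
      rw [hB, map_mul, map_star, ContinuousLinearMap.star_eq_adjoint]
    rw [h1]
    change inner ℝ (T B⁻¹ u) (ContinuousLinearMap.adjoint (T B) (T B (T B⁻¹ v))) = inner ℝ u v
    rw [ContinuousLinearMap.adjoint_inner_right, hTB, hTB]

end Whitening

/-! ### Convergence to the chi-squared law -/

section ChiSquared

variable {q : ℕ} {Ω : Type*} [MeasurableSpace Ω] {P : Measure Ω} [IsProbabilityMeasure P]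

theorem tendstoInDistribution_norm_sq_chiSquared {Z : ℕ → Ω → EuclideanSpace ℝ (Fin q)}
    (hZ : TendstoInDistribution Z atTop (WithLp.toLp 2) (fun _ => P)
      (Measure.pi fun _ : Fin q => gaussianReal 0 1)) :
    TendstoInDistribution (fun n ω => ‖Z n ω‖ ^ 2) atTop id (fun _ => P) (chiSquared q) := by
  have h := hZ.continuous_comp (g := fun u : EuclideanSpace ℝ (Fin q) => ‖u‖ ^ 2) (by fun_prop)
  refine ⟨h.forall_aemeasurable, aemeasurable_id, ?_⟩
  have hlim := h.tendsto
  have heq : (Measure.pi fun _ : Fin q => gaussianReal 0 1).map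
      ((fun u : EuclideanSpace ℝ (Fin q) => ‖u‖ ^ 2) ∘ WithLp.toLp 2) =
      (chiSquared q).map id := by
    rw [Measure.map_id, chiSquared]
    congr 1
    funext z
    simp [EuclideanSpace.real_norm_sq_eq]
  have hsub : (⟨_, Measure.isProbabilityMeasure_map h.aemeasurable_limit⟩ :
      ProbabilityMeasure ℝ) = ⟨(chiSquared q).map id,
        Measure.isProbabilityMeasure_map aemeasurable_id⟩ := Subtype.ext heq
  rw [hsub] at hlim
  exact hlim

variable {g : ℕ → Ω → EuclideanSpace ℝ (Fin q)}
  {A : EuclideanSpace ℝ (Fin q) →L[ℝ] EuclideanSpace ℝ (Fin q)}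

/-- Carries a solution for the standardized vectors back to the original ones: the adjoint preserves
the inner products, and injectivity of `A` removes it from the equation. For `n ≥ 2` the bound `1 +
a ≥ 3/4` exceeds `1/n`. -/
theorem isVectorMultiplier_adjoint {n : ℕ} (hn : 2 ≤ n) (hA : Function.Injective A)
    {w : Fin n → EuclideanSpace ℝ (Fin q)} {c : ℝ} (hc : c ≠ 0) {s : EuclideanSpace ℝ (Fin q)}
    (hsmall : ∀ i, |inner ℝ s (c • A (w i))| ≤ 1 / 4)
    (hs : ∑ i, (1 / (1 + inner ℝ s (c • A (w i)))) • (c • A (w i)) = 0) :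
    IsVectorMultiplier w (ContinuousLinearMap.adjoint A (c • s)) := by
  have hinner : ∀ i, inner ℝ (ContinuousLinearMap.adjoint A (c • s)) (w i) =
      inner ℝ s (c • A (w i)) := fun i => by
    rw [ContinuousLinearMap.adjoint_inner_left, real_inner_smul_left, real_inner_smul_right]
  refine ⟨fun i => ?_, ?_⟩
  · rw [hinner]
    have h1 : 1 / (n : ℝ) ≤ 1 / 2 := by
      have : (2 : ℝ) ≤ n := by exact_mod_cast hn
      gcongr
    linarith [(abs_le.mp (hsmall i)).1]
  · simp only [hinner]
    have h2 : A (∑ i, (1 / (1 + inner ℝ s (c • A (w i)))) • w i) = 0 := by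
      refine (smul_eq_zero.mp ?_).resolve_left hc
      rw [← hs, map_sum, Finset.smul_sum]
      exact Finset.sum_congr rfl fun i _ => by rw [map_smul, smul_comm]
    rw [(injective_iff_map_eq_zero A).mp hA _ h2, smul_zero]

/-- Limit law of the statistics `∑ f(tᵀgᵢ)` for i.i.d. centred vectors with a nondegenerate second
moment matrix, a finite third moment, and `f(a) = a² + o(a²)`. -/
theorem tendstoInDistribution_sum_inner_vectorMultiplier {f : ℝ → ℝ}
    (hfc : ContinuousOn f (Set.Ioi (-1))) (hf0 : f 0 = 0)
    (hf : ∀ κ > 0, ∃ η > 0, ∀ a, |a| ≤ η → |f a - a ^ 2| ≤ κ * a ^ 2)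
    (hindep : iIndepFun g P) (hident : ∀ i, IdentDistrib (g i) (g 0) P P)
    (hmean : P[g 0] = 0) (hL3 : MemLp (g 0) 3 P)
    (hpos : (Matrix.of fun j k : Fin q => ∫ ω, g 0 ω j * g 0 ω k ∂P).PosDef) :
    TendstoInDistribution
      (fun (n : ℕ) ω => ∑ i : Fin n, f (inner ℝ (vectorMultiplier fun i : Fin n => g i ω) (g i ω)))
      atTop id (fun _ => P) (chiSquared q) := by
  have hL2 : MemLp (g 0) 2 P := hL3.mono_exponent (by norm_num)
  have hcoord : ∀ j, MemLp (fun ω => g 0 ω j) 2 P := fun j =>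
    (EuclideanSpace.proj (𝕜 := ℝ) j).comp_memLp' hL2
  obtain ⟨A, hA, hcov⟩ := exists_injective_standardization (μ := P) (g := g 0)
    (fun j k => (hcoord j).integrable_mul (hcoord k)) hpos
  set W : ℕ → Ω → EuclideanSpace ℝ (Fin q) := fun i ω => A (g i ω) with hW
  have hWindep : iIndepFun W P := hindep.comp (fun _ => A) fun _ => A.measurable
  have hWident : ∀ i, IdentDistrib (W i) (W 0) P P := fun i => (hident i).comp A.measurable
  have hWL3 : MemLp (W 0) 3 P := A.comp_memLp' hL3
  have hWL2 : MemLp (W 0) 2 P := hWL3.mono_exponent (by norm_num)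
  have hWmean : P[W 0] = 0 := by
    rw [hW]
    rw [A.integral_comp_comm (hL2.integrable (by norm_num)), hmean, map_zero]
  have hclt := tendstoInDistribution_inv_sqrt_smul_sum hWindep hWident hWL2 hWmean fun u => by
    rw [← real_inner_self_eq_norm_sq, ← hcov u u]
    simp only [pow_two, hW]
  set Z : ℕ → Ω → EuclideanSpace ℝ (Fin q) :=
    fun n ω => (√(n : ℝ))⁻¹ • ∑ k ∈ Finset.range n, W k ω with hZ
  set T : ℕ → Ω → ℝ := fun n ω =>
    ∑ i : Fin n, f (inner ℝ (vectorMultiplier fun i : Fin n => g i ω) (g i ω)) with hT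
  -- Slutsky: it suffices that the statistic differs from `‖Z n‖²` by a term tending to zero in
  -- probability.
  refine tendstoInDistribution_of_tendstoInMeasure_sub T id
    (tendstoInDistribution_norm_sq_chiSquared hclt) ?_ fun n => ?_
  · refine tendstoInMeasure_iff_norm.2 fun ε hε => ENNReal.tendsto_nhds_zero.2 fun ρ hρ => ?_
    have hρ3 : 0 < ρ / 3 := ENNReal.div_pos hρ.ne' (by norm_num)
    obtain ⟨M, hM, hZM⟩ := exists_measure_norm_gt_le hclt hρ3
    obtain ⟨δ, hδ, hdet⟩ := exists_abs_sum_sub_norm_sq_le (E := EuclideanSpace ℝ (Fin q)) hf hM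
      (half_pos hε)
    have hmax := ENNReal.tendsto_nhds_zero.1 (tendsto_measure_exists_norm_gt hWident
      (hWL3.integrable_norm_pow (by norm_num)) hδ) _ hρ3
    have hlln := ENNReal.tendsto_nhds_zero.1
      (tendsto_measure_norm_sum_rankOne_sub_gt hWindep hWident hWL2 hcov hδ) _ hρ3
    filter_upwards [hmax, hlln, eventually_ge_atTop 2] with n h1 h2 hn
    have hn0 : (0 : ℝ) < n := by exact_mod_cast (by omega : 0 < n)
    have hsq : 0 < √(n : ℝ) := Real.sqrt_pos.mpr hn0
    -- Outside these three events, each of probability at most `ρ/3`, the deterministic expansion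
    -- bounds the difference by `ε/2 < ε`.
    refine (measure_mono (t := ({ω | ∃ i : Fin n, δ * √(n : ℝ) < ‖W i ω‖} ∪
      {ω | δ < ‖(n : ℝ)⁻¹ • ∑ k ∈ Finset.range n, InnerProductSpace.rankOne ℝ (W k ω) (W k ω) -
        ContinuousLinearMap.id ℝ (EuclideanSpace ℝ (Fin q))‖}) ∪ {ω | M < ‖Z n ω‖})
      fun ω hω => ?_).trans ?_
    · by_contra hnot
      simp only [Set.mem_union, Set.mem_ofPred_eq, not_or, not_exists, not_lt] at hnot
      obtain ⟨⟨hm, hl⟩, hz⟩ := hnot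
      have hsum : ∑ i : Fin n, (√(n : ℝ))⁻¹ • W i ω = Z n ω := by
        simp only [hZ, ← Finset.smul_sum, Finset.sum_range]
      have hrank : ∑ i : Fin n, InnerProductSpace.rankOne ℝ ((√(n : ℝ))⁻¹ • W i ω)
          ((√(n : ℝ))⁻¹ • W i ω) =
          (n : ℝ)⁻¹ • ∑ k ∈ Finset.range n, InnerProductSpace.rankOne ℝ (W k ω) (W k ω) := by
        rw [Finset.sum_range, Finset.smul_sum]
        refine Finset.sum_congr rfl fun i _ => ?_
        ext1 u
        simp only [InnerProductSpace.rankOne_apply, real_inner_smul_left, smul_smul,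
          _root_.smul_apply]
        congr 1
        nth_rewrite 3 [← Real.mul_self_sqrt hn0.le]
        field_simp
      obtain ⟨s, hs1, hs2, hs3⟩ := hdet n (fun i => (√(n : ℝ))⁻¹ • W i ω) (fun i => by
          rw [norm_smul, Real.norm_eq_abs, abs_of_pos (inv_pos.mpr hsq), inv_mul_le_iff₀ hsq,
            mul_comm]
          exact hm i) (by rw [hrank]; exact hl) (by rw [hsum]; exact hz)
      have hmult := isVectorMultiplier_adjoint (w := fun i : Fin n => g i ω) hn hA
        (inv_pos.mpr hsq).ne' hs1 hs2
      -- The chosen multiplier may differ from the one built from `s`, but the inner products agree.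
      have hTs : T n ω = ∑ i : Fin n, f (inner ℝ s ((√(n : ℝ))⁻¹ • W i ω)) := by
        refine Finset.sum_congr rfl fun i _ => ?_
        rw [hmult.inner_vectorMultiplier i, ContinuousLinearMap.adjoint_inner_left,
          real_inner_smul_left, real_inner_smul_right]
      have hω' : ε ≤ |T n ω - ‖Z n ω‖ ^ 2| := by simpa using hω
      rw [hsum, ← hTs] at hs3
      linarith
    · calc _ ≤ ρ / 3 + ρ / 3 + ρ / 3 :=
          (measure_union_le _ _).trans
            (add_le_add ((measure_union_le _ _).trans (add_le_add h1 h2)) (hZM n))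
        _ = ρ := ENNReal.add_thirds ρ
  · exact (measurable_sum_inner_vectorMultiplier hfc hf0 n).comp_aemeasurable
      (aemeasurable_pi_lambda _ fun i => (hident i).aemeasurable_fst)

end ChiSquared

/-! ### Application to the logistic scores -/

theorem continuous_score {q : ℕ} (β : EuclideanSpace ℝ (Fin q)) :
    Continuous fun z : EuclideanSpace ℝ (Fin q) × ℝ => score z.1 z.2 β := by
  have h : Continuous fun z : EuclideanSpace ℝ (Fin q) × ℝ => Real.sigmoid (inner ℝ z.1 β) :=
    continuous_sigmoid.comp (by fun_prop)
  exact (continuous_snd.sub h).smul continuous_fst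

/-- Under the null hypothesis the scores have a finite third moment. -/
theorem CondC6.memLp_three {q : ℕ} {ν : Measure (EuclideanSpace ℝ (Fin q) × ℝ)}
    {β₀ : EuclideanSpace ℝ (Fin q)} (h : CondC6 ν β₀) :
    MemLp (fun z : EuclideanSpace ℝ (Fin q) × ℝ => score z.1 z.2 β₀) 3 ν := by
  obtain ⟨G, hG, U, hU, hbound⟩ := h
  have hmeas : AEStronglyMeasurable
      (fun z : EuclideanSpace ℝ (Fin q) × ℝ => score z.1 z.2 β₀) ν :=
    (continuous_score β₀).aestronglyMeasurable
  have h3 : Integrable (fun z : EuclideanSpace ℝ (Fin q) × ℝ => ‖score z.1 z.2 β₀‖ ^ 3) ν := by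
    refine hG.mono' (hmeas.norm.pow 3) ?_
    filter_upwards [hbound] with z hz
    rw [Real.norm_eq_abs, abs_of_nonneg (by positivity)]
    exact (hz β₀ (mem_of_mem_nhds hU)).2
  refine (integrable_norm_rpow_iff hmeas (by norm_num) (by norm_num)).mp ?_
  refine h3.congr (Eventually.of_forall fun z => ?_)
  simp only [ENNReal.toReal_ofNat]
  norm_cast

/-- Transfers the conditions from `ν` to the sample space: `CondC1` centres the scores, `CondC6`
gives the third moment, `CondC4` nondegeneracy. -/
theorem tendstoInDistribution_phiStatistic {q : ℕ} {Ω : Type*} [MeasurableSpace Ω]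
    {P : Measure Ω} [IsProbabilityMeasure P] {X : ℕ → Ω → EuclideanSpace ℝ (Fin q)}
    {Y : ℕ → Ω → ℝ} {ν : Measure (EuclideanSpace ℝ (Fin q) × ℝ)}
    (hlaw : ∀ i, HasLaw (fun ω => (X i ω, Y i ω)) ν P)
    (hindep : iIndepFun (fun i ω => (X i ω, Y i ω)) P) {β₀ : EuclideanSpace ℝ (Fin q)}
    (hC1 : CondC1 ν β₀) (hC4 : CondC4 ν β₀) (hC6 : CondC6 ν β₀) {φ : ℝ → ℝ}
    (hφ : IsDivergenceFunction φ) :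
    TendstoInDistribution
      (fun (n : ℕ) ω => phiStatistic φ (fun i : Fin n => X i ω) (fun i : Fin n => Y i ω) β₀)
      atTop id (fun _ => P) (chiSquared q) := by
  have hmeas := (continuous_score β₀).measurable
  have hident : ∀ i, IdentDistrib (fun ω => (X i ω, Y i ω)) (fun ω => (X 0 ω, Y 0 ω)) P P :=
    fun i => ⟨(hlaw i).aemeasurable, (hlaw 0).aemeasurable,
      (hlaw i).map_eq.trans (hlaw 0).map_eq.symm⟩
  simp only [phiStatistic_eq_sum]
  refine tendstoInDistribution_sum_inner_vectorMultiplier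
    (g := fun i ω => score (X i ω) (Y i ω) β₀) hφ.continuousOn_divergenceKernel
    hφ.divergenceKernel_zero (fun κ hκ => hφ.abs_divergenceKernel_sub_le hκ)
    (hindep.comp (fun _ z => score z.1 z.2 β₀) fun _ => hmeas)
    (fun i => (hident i).comp hmeas) ?_ ?_ ?_
  · rw [← ((hC1 β₀).mpr rfl).2]
    exact (hlaw 0).integral_comp (continuous_score β₀).aestronglyMeasurable
  · have h := hC6.memLp_three
    rw [← (hlaw 0).map_eq] at h
    exact h.comp_of_map (hlaw 0).aemeasurable
  · convert hC4.2 using 4 with j k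
    exact (hlaw 0).integral_comp (f := fun z => score z.1 z.2 β₀ j * score z.1 z.2 β₀ k)
      (hC4.1 j k).aestronglyMeasurable

end LogisticEL

theorem theorem1 {q : ℕ} {Ω : Type*} [MeasurableSpace Ω] (P : Measure Ω) [IsProbabilityMeasure P]
    -- the i.i.d. sample of `(X, Y)`, whose joint law is `ν`
    (X : ℕ → Ω → EuclideanSpace ℝ (Fin q)) (Y : ℕ → Ω → ℝ)
    (ν : Measure (EuclideanSpace ℝ (Fin q) × ℝ)) [IsProbabilityMeasure ν]
    (hlaw : ∀ i, HasLaw (fun ω => (X i ω, Y i ω)) ν P)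
    (hindep : iIndepFun (fun i ω => (X i ω, Y i ω)) P)
    -- the logistic regression model holds, and the null hypothesis is true
    (β₀ : EuclideanSpace ℝ (Fin q)) (hmodel : IsLogisticModel ν β₀)
    (hC1 : CondC1 ν β₀)
    -- the two conditions on the sample hold with probability tending to one
    (hC2 : Tendsto (fun n : ℕ =>
      P {ω | CondC2 (fun i : Fin n => X i ω) (fun i : Fin n => Y i ω) β₀}) atTop (𝓝 1))
    (hC3 : Tendsto (fun n : ℕ =>
      P {ω | CondC3 (fun i : Fin n => X i ω) (fun i : Fin n => Y i ω) β₀}) atTop (𝓝 1))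
    (hC4 : CondC4 ν β₀) (hC5 : CondC5 ν β₀) (hC6 : CondC6 ν β₀) (hC7 : CondC7 ν β₀)
    (hC8 : CondC8 ν β₀) (hC9 : CondC9 ν β₀) :
    (∀ φ : ℝ → ℝ, IsDivergenceFunction φ →
      TendstoInDistribution
        (fun (n : ℕ) ω => phiStatistic φ (fun i : Fin n => X i ω) (fun i : Fin n => Y i ω) β₀)
        atTop id (fun _ => P) (chiSquared q)) ∧
    TendstoInDistribution
      (fun (n : ℕ) ω =>
        likelihoodRatioStatistic (fun i : Fin n => X i ω) (fun i : Fin n => Y i ω) β₀)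
      atTop id (fun _ => P) (chiSquared q) := by
  have key := fun φ (hφ : IsDivergenceFunction φ) =>
    tendstoInDistribution_phiStatistic hlaw hindep hC1 hC4 hC6 hφ
  refine ⟨key, ?_⟩
  simp only [likelihoodRatioStatistic_eq_phiStatistic]
  exact key _ isDivergenceFunction_entropyFunction
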